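/- An MV-algebra is an algebra $\mathbf A=(A,\oplus,\neg,0)$ of type $(2,1,0)$ such that, for all $x,y,z\in A$ and with $1:=\neg 0$: $x\oplus y=y\oplus x$; $x\oplus(y\oplus z)=(x\oplus y)\oplus z$; $x\oplus 0=x$; $\neg\neg x=x$; $x\oplus 1=1$; $\neg(\neg x\oplus y)\oplus y=\neg(\neg y\oplus x)\oplus x$. Put $x\le y$ iff $\neg x\oplus y=1$; $\mathbf A$ is linearly ordered (an MV-chain) if $x\le y$ or $y\le x$ for all $x,y\in A$. For an integer $k\ge 1$ let $\mathbf L_k$ be the MV-chain on $\{0,\frac1k,\frac2k,\dots,1\}\subseteq[0,1]$ with $x\oplus y=\min\{x+y,1\}$ and $\neg x=1-x$. For $X\subseteq A$ let $\mathbf A|_X$ be the partial algebra on $X$ in which an operation of $\mathbf A$ is defined at a tuple of elements of $X$ exactly when its value in $\mathbf A$ lies in $X$, and then has this value. An embedding of $\mathbf A|_X$ into an MV-algebra $\mathbf B$ is an injective map $X\to B$ that preserves each of $\oplus,\neg,0$ wherever it is defined in $\mathbf A|_X$. A class $\mathcal K$ of MV-algebras has the finite embedding property (FEP) if for every $\mathbf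 A\in\mathcal K$ and every finite $X\subseteq A$ there are a finite $\mathbf B\in\mathcal K$ and an embedding of $\mathbf A|_X$ into $\mathbf B$. **Theorem 5.** (1) The class of linearly ordered MV-algebras has the FEP. Moreover, for every linearly ordered MV-algebra $\mathbf M$ with more than one element and every finite $X\subseteq M$ there are an integer $k\ge 1$ and an embedding of $\mathbf M|_X$ into $\mathbf L_k$. (2) The class of all MV-algebras has the FEP. Moreover, for every MV-algebra $\mathbf M$ and every finite $X\subseteq M$ there are integers $k\ge 1$ and $l\ge 0$ and an embedding of $\mathbf M|_X$ into the power $(\mathbf L_k)^l$. -/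

import Mathlib

universe u v

/-- MV-algebras: algebras `(A, ⊕, ¬, 0)` of type `(2, 1, 0)`. -/
class MVAlgebra (A : Type u) where
  oplus : A → A → A
  neg : A → A
  zero : A
  oplus_comm : ∀ x y, oplus x y = oplus y x
  oplus_assoc : ∀ x y z, oplus x (oplus y z) = oplus (oplus x y) z
  oplus_zero : ∀ x, oplus x zero = x
  neg_neg : ∀ x, neg (neg x) = x
  oplus_one : ∀ x, oplus x (neg zero) = neg zero
  lukasiewicz : ∀ x y, oplus (neg (oplus (neg x) y)) y = oplus (neg (oplus (neg y) x)) x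

namespace MVAlgebra

/-- The constant `1 := ¬0`. -/
def one (A : Type u) [MVAlgebra A] : A := neg zero

/-- The natural order: `x ≤ y` iff `¬x ⊕ y = 1`. -/
def le {A : Type u} [MVAlgebra A] (x y : A) : Prop := oplus (neg x) y = one A

/-- Linearly ordered MV-algebras (MV-chains). -/
def IsChain (A : Type u) [MVAlgebra A] : Prop := ∀ x y : A, le x y ∨ le y x

/-- `ρ` is an embedding of the partial algebra `A|_X` into the MV-algebra `B`. An operation of
`A|_X` is defined at a tuple of elements of `X` exactly when its value in `A` lies in `X`, and
`ρ` is an injective map which preserves every operation wherever it is defined. -/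
structure IsPartialEmbedding {A : Type u} {B : Type v} [MVAlgebra A] [MVAlgebra B]
    (X : Set A) (ρ : X → B) : Prop where
  injective : Function.Injective ρ
  map_zero : ∀ h : (zero : A) ∈ X, ρ ⟨zero, h⟩ = zero
  map_neg : ∀ (x : X) (h : neg (x : A) ∈ X), ρ ⟨neg (x : A), h⟩ = neg (ρ x)
  map_oplus : ∀ (x y : X) (h : oplus (x : A) (y : A) ∈ X),
    ρ ⟨oplus (x : A) (y : A), h⟩ = oplus (ρ x) (ρ y)

/-- The MV-algebra `A` has the finite embedding property for the class `K`. -/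
def HasFEPFor (A : Type u) [MVAlgebra A] (K : (B : Type v) → [MVAlgebra B] → Prop) : Prop :=
  ∀ X : Set A, X.Finite →
    ∃ (B : Type v) (_ : MVAlgebra B), Finite B ∧ K B ∧ ∃ ρ : X → B, IsPartialEmbedding X ρ

/-- A class `K` of MV-algebras has the finite embedding property if every member of `K` has the
finite embedding property for `K`. -/
def ClassHasFEP (K : (A : Type u) → [MVAlgebra A] → Prop) : Prop :=
  ∀ (A : Type u) [MVAlgebra A], K A → HasFEPFor A K

/-- The class of linearly ordered MV-algebras. -/
def LMV (A : Type u) [MVAlgebra A] : Prop := IsChain A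

/-- The class of all MV-algebras. -/
def MV (A : Type u) [MVAlgebra A] : Prop := True

/-- The universe `{0, 1/k, 2/k, …, 1} ⊆ [0, 1]` of the finite chain `Ł_k`, where `k ≥ 1`. -/
def FinChain (k : ℕ+) : Type := {r : ℝ // ∃ i : ℕ, i ≤ (k : ℕ) ∧ r = (i : ℝ) / ((k : ℕ) : ℝ)}

namespace FinChain

theorem val_mem {k : ℕ+} (x : FinChain k) : 0 ≤ x.1 ∧ x.1 ≤ 1 := by
  obtain ⟨r, i, hi, rfl⟩ := x
  have hk : (0 : ℝ) < ((k : ℕ) : ℝ) := by exact_mod_cast k.pos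
  have hi' : (i : ℝ) ≤ ((k : ℕ) : ℝ) := by exact_mod_cast hi
  exact ⟨by positivity, (div_le_one hk).2 hi'⟩

/-- The chain `Ł_k`, with `x ⊕ y = min (x + y) 1`, `¬x = 1 - x`. -/
noncomputable instance (k : ℕ+) : MVAlgebra (FinChain k) where
  oplus x y := ⟨min (x.1 + y.1) 1, by
    obtain ⟨r, i, hi, rfl⟩ := x
    obtain ⟨s, j, hj, rfl⟩ := y
    have hk : (0 : ℝ) < ((k : ℕ) : ℝ) := by exact_mod_cast k.pos
    refine ⟨min (i + j) k, min_le_right _ _, ?_⟩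
    rw [Nat.cast_min, ← min_div_div_right hk.le, div_self hk.ne', Nat.cast_add, add_div]⟩
  neg x := ⟨1 - x.1, by
    obtain ⟨r, i, hi, rfl⟩ := x
    have hk : (0 : ℝ) < ((k : ℕ) : ℝ) := by exact_mod_cast k.pos
    refine ⟨k - i, Nat.sub_le _ _, ?_⟩
    rw [Nat.cast_sub hi, sub_div, div_self hk.ne']⟩
  zero := ⟨0, 0, Nat.zero_le _, by simp⟩
  oplus_comm x y := Subtype.ext (by simp only [add_comm])
  oplus_assoc x y z := Subtype.ext (by
    have := val_mem x; have := val_mem y; have := val_mem z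
    simp only []; grind)
  oplus_zero x := Subtype.ext (by have := val_mem x; simp only []; grind)
  neg_neg x := Subtype.ext (by simp)
  oplus_one x := Subtype.ext (by have := val_mem x; simp only []; grind)
  lukasiewicz x y := Subtype.ext (by
    have := val_mem x; have := val_mem y
    simp only []; grind)

end FinChain

/-- Powers of an MV-algebra, with the pointwise operations. -/
instance instPower (ι : Type v) (A : Type u) [MVAlgebra A] : MVAlgebra (ι → A) where
  oplus f g i := oplus (f i) (g i)
  neg f i := neg (f i)
  zero _ := zero
  oplus_comm f g := funext fun i => oplus_comm (f i) (g i)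
  oplus_assoc f g h := funext fun i => oplus_assoc (f i) (g i) (h i)
  oplus_zero f := funext fun i => oplus_zero (f i)
  neg_neg f := funext fun i => neg_neg (f i)
  oplus_one f := funext fun i => oplus_one (f i)
  lukasiewicz f g := funext fun i => lukasiewicz (f i) (g i)

end MVAlgebra

/-! A nontrivial MV-chain is the unit interval of Chang's group, built here as pairs `n + a` with
carry. No order on this group is needed, only that its positive cone is pointed: finitely many
nonzero elements of the chain then satisfy no nontrivial relation with coefficients in `ℕ`, so some
homomorphism to `ℚ` is positive on all of them (`exists_addMonoidHom_rat_pos`). Applied to the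
differences of elements of a finite set and normalized at `1`, it is a strictly monotone rational
valuation, and a common denominator of its values gives `k`
(`IsChain.exists_isPartialEmbedding_finChain`).

For an arbitrary algebra, distinct elements are separated by a quotient chain
(`exists_hom_chain_ne`). The chain case applies to each such quotient, and one coordinate for every
pair of distinct elements of `X` gives an embedding into a power. -/

/-! ### Positive homomorphisms to `ℚ` -/

/-- A family in an abelian group without nontrivial vanishing combinations over `ℕ` is positive
under some homomorphism to `ℚ`. -/
theorem exists_addMonoidHom_rat_pos {n : ℕ} {G : Type u} [AddCommGroup G] (p : Fin n → G)
    (hp : ∀ c : Fin n → ℕ, ∑ i, c i • p i = 0 → c = 0) :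
    ∃ f : G →+ ℚ, ∀ i, 0 < f (p i) := by
  induction n generalizing G with
  | zero => exact ⟨0, fun i => i.elim0⟩
  | succ n ih =>
    set q := p (Fin.last n) with hq
    let π := QuotientAddGroup.mk' (AddSubgroup.zmultiples q)
    -- Pass to the quotient by `q`. If the other images stay independent over `ℕ`, a large multiple
    -- of a functional from the quotient corrects an extension of `q ↦ 1` without changing its value
    -- at `q`. The extension exists because `ℚ` is divisible.
    by_cases h : ∀ c : Fin n → ℕ, ∑ i, c i • π (p i.castSucc) = 0 → c = 0
    · obtain ⟨g, hg⟩ := ih (fun i => π (p i.castSucc)) h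
      have hinj : Function.Injective (zmultiplesHom G q) := by
        refine (injective_iff_map_eq_zero _).2 fun m hm => ?_
        have key : ∀ k : ℕ, k • q = 0 → k = 0 := fun k hk => by
          have := hp (Pi.single (Fin.last n) k) (by
            rw [Finset.sum_eq_single (Fin.last n)]
            · simpa using hk
            · intro b _ hb; simp [hb]
            · simp)
          simpa using congrFun this (Fin.last n)
        have hm' : m • q = 0 := by simpa using hm
        rcases Int.natAbs_eq m with e | e
        · have := key m.natAbs (by rw [← natCast_zsmul, ← e, hm'])
          omega
        · have := key m.natAbs (by
            rw [← natCast_zsmul, ← neg_eq_zero, ← neg_zsmul, ← e, hm'])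
          omega
      obtain ⟨h', hh'⟩ := Module.Baer.extension_property_addMonoidHom
        (Module.Baer.of_divisible ℚ) (zmultiplesHom G q) hinj (Int.castAddHom ℚ)
      have h1 : h' q = 1 := by
        have := DFunLike.congr_fun hh' 1
        simpa using this
      obtain ⟨N, hN⟩ : ∃ N : ℕ, ∀ i : Fin n, -(h' (p i.castSucc)) / g (π (p i.castSucc)) < N := by
        obtain ⟨B, hB⟩ := (Set.finite_range
          (fun i : Fin n => -(h' (p i.castSucc)) / g (π (p i.castSucc)))).bddAbove
        obtain ⟨N, hN⟩ := exists_nat_gt B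
        exact ⟨N, fun i => (hB ⟨i, rfl⟩).trans_lt hN⟩
      refine ⟨h' + N • g.comp π, fun i => ?_⟩
      refine Fin.lastCases ?_ (fun i => ?_) i
      · have : π q = 0 := (QuotientAddGroup.eq_zero_iff _).2 (AddSubgroup.mem_zmultiples q)
        simp [← hq, h1, this]
      · have := (div_lt_iff₀ (hg i)).1 (hN i)
        simp only [AddMonoidHom.add_apply, AddMonoidHom.smul_apply, AddMonoidHom.comp_apply,
          nsmul_eq_mul]
        linarith
    -- A relation in the quotient lifts to `m • q = ∑ c i • p i` with `m > 0`, so any functional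
    -- positive on the other elements is positive at `q` too.
    · push Not at h
      obtain ⟨c, hc, hc0⟩ := h
      obtain ⟨m, hm⟩ : ∃ m : ℤ, m • q = ∑ i, c i • p i.castSucc := by
        have : π (∑ i, c i • p i.castSucc) = 0 := by simpa using hc
        exact AddSubgroup.mem_zmultiples_iff.1 ((QuotientAddGroup.eq_zero_iff _).1 this)
      have hmpos : 0 < m := by
        by_contra hle
        refine hc0 ?_
        have := hp (Fin.snoc c (-m).toNat) (by
          rw [Fin.sum_univ_castSucc]
          simp only [Fin.snoc_castSucc, Fin.snoc_last]
          rw [← hm, ← hq, ← natCast_zsmul, Int.toNat_of_nonneg (by omega), neg_zsmul,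
            add_neg_cancel])
        funext i
        simpa using congrFun this i.castSucc
      obtain ⟨f, hf⟩ := ih (fun i => p i.castSucc) fun d hd => by
        have := hp (Fin.snoc d 0) (by
          rw [Fin.sum_univ_castSucc]
          simpa using hd)
        funext i
        simpa using congrFun this i.castSucc
      refine ⟨f, fun i => ?_⟩
      refine Fin.lastCases ?_ hf i
      have hs : (m : ℚ) * f q = ∑ i, (c i : ℚ) * f (p i.castSucc) := by
        have := congrArg f hm
        simpa using this
      have hpos : 0 < ∑ i, (c i : ℚ) * f (p i.castSucc) := by
        obtain ⟨j, hj⟩ := Function.ne_iff.1 hc0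
        refine Finset.sum_pos' (fun i _ => mul_nonneg (Nat.cast_nonneg _) (hf i).le)
          ⟨j, Finset.mem_univ _, mul_pos ?_ (hf j)⟩
        exact_mod_cast Nat.pos_of_ne_zero hj
      rw [← hs] at hpos
      exact pos_of_mul_pos_right hpos (by exact_mod_cast hmpos.le)

namespace MVAlgebra

local infixl:65 " ⊹ " => oplus
local prefix:max "∼" => neg

/-! ### Arithmetic and order in MV-algebras -/

section Basic

variable {M : Type u} [MVAlgebra M]

instance : Std.Commutative (oplus : M → M → M) := ⟨oplus_comm⟩
instance : Std.Associative (oplus : M → M → M) := ⟨fun x y z => (oplus_assoc x y z).symm⟩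

theorem zero_oplus (x : M) : zero ⊹ x = x := by rw [oplus_comm, oplus_zero]

theorem one_oplus (x : M) : ∼zero ⊹ x = ∼zero := by rw [oplus_comm, oplus_one]

theorem neg_injective : Function.Injective (neg : M → M) :=
  Function.LeftInverse.injective neg_neg

theorem neg_oplus_self (x : M) : ∼x ⊹ x = ∼zero := by
  have := lukasiewicz x (∼zero)
  rwa [oplus_one, neg_neg, zero_oplus, eq_comm] at this

theorem le_iff {x y : M} : le x y ↔ ∼x ⊹ y = ∼zero := Iff.rfl

theorem le_refl (x : M) : le x x := neg_oplus_self x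

theorem le_antisymm {x y : M} (h : le x y) (h' : le y x) : x = y := by
  have := lukasiewicz x y
  rw [le_iff.1 h, le_iff.1 h', neg_neg, zero_oplus, zero_oplus] at this
  exact this.symm

theorem le_oplus_right (x y : M) : le x (x ⊹ y) := by
  rw [le_iff, oplus_assoc, neg_oplus_self, one_oplus]

theorem le_oplus_left (x y : M) : le y (x ⊹ y) := by
  rw [oplus_comm]; exact le_oplus_right y x

theorem sub_oplus_cancel {x y : M} (h : le x y) : ∼(∼y ⊹ x) ⊹ x = y := by
  rw [← lukasiewicz, le_iff.1 h, neg_neg, zero_oplus]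

theorem le_trans {x y z : M} (h : le x y) (h' : le y z) : le x z := by
  rw [← sub_oplus_cancel h', ← sub_oplus_cancel h, oplus_assoc]
  exact le_oplus_left _ _

theorem zero_le (x : M) : le zero x := one_oplus x

theorem le_one (x : M) : le x (∼zero) := oplus_one _

theorem eq_zero_of_le_zero {x : M} (h : le x zero) : x = zero := le_antisymm h (zero_le x)

theorem eq_one_of_one_le {x : M} (h : le (∼zero) x) : x = ∼zero := le_antisymm (le_one x) h

theorem oplus_le_oplus {x y z w : M} (h : le x y) (h' : le z w) : le (x ⊹ z) (y ⊹ w) := by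
  rw [← sub_oplus_cancel h', ← sub_oplus_cancel h]
  generalize ∼(∼y ⊹ x) = a
  generalize ∼(∼w ⊹ z) = b
  have : a ⊹ x ⊹ (b ⊹ z) = x ⊹ z ⊹ (a ⊹ b) := by ac_rfl
  rw [this]
  exact le_oplus_right _ _

theorem neg_le_neg {x y : M} (h : le x y) : le (∼y) (∼x) := by
  rwa [le_iff, neg_neg, oplus_comm]

theorem neg_le_comm {x y : M} (h : le (∼x) y) : le (∼y) x := by
  simpa only [neg_neg] using neg_le_neg h

theorem le_neg_comm {x y : M} (h : le x (∼y)) : le y (∼x) := by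
  simpa only [neg_neg] using neg_le_neg h

theorem sub_le_iff {t x y : M} : le (∼(∼t ⊹ x)) y ↔ le t (x ⊹ y) := by
  rw [le_iff, le_iff, neg_neg, oplus_assoc]

theorem oplus_eq_zero {x y : M} (h : x ⊹ y = zero) : x = zero :=
  eq_zero_of_le_zero (h ▸ le_oplus_right x y)

/-- The meet of two elements. -/
def inf (x y : M) : M := ∼(∼(x ⊹ ∼y) ⊹ ∼y)

theorem inf_comm (x y : M) : inf x y = inf y x := by
  have := lukasiewicz (∼x) (∼y)
  rw [neg_neg, neg_neg] at this
  rw [inf, inf, this]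

theorem inf_le_right (x y : M) : le (inf x y) y := by
  have := neg_le_neg (le_oplus_left (∼(x ⊹ ∼y)) (∼y))
  rwa [neg_neg] at this

theorem inf_le_left (x y : M) : le (inf x y) x := inf_comm x y ▸ inf_le_right y x

theorem inf_eq_left {x y : M} (h : le x y) : inf x y = x := by
  have := sub_oplus_cancel (neg_le_neg h)
  rw [neg_neg] at this
  rw [inf, this, neg_neg]

theorem inf_le_inf_left {x y : M} (z : M) (h : le x y) : le (inf x z) (inf y z) :=
  neg_le_neg (oplus_le_oplus (neg_le_neg (oplus_le_oplus h (le_refl _))) (le_refl _))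

theorem le_inf {x y z : M} (h : le z x) (h' : le z y) : le z (inf x y) :=
  inf_eq_left h' ▸ inf_le_inf_left y h

theorem inf_self (x : M) : inf x x = x := inf_eq_left (le_refl x)

theorem oplus_inf_le {t x y z : M} (h : le t (x ⊹ y)) (h' : le t (x ⊹ z)) :
    le t (x ⊹ inf y z) :=
  sub_le_iff.1 (le_inf (sub_le_iff.2 h) (sub_le_iff.2 h'))

/-- By residuation a bound by `u ⊕ (v ∧ w)` follows from bounds by `u ⊕ v` and `u ⊕ w`. Expanding
both meets leaves only `x ⊕ y` and sums containing `z`. -/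
theorem oplus_inf_le_inf_oplus_inf (x y z : M) :
    le (inf (x ⊹ y) z) (inf x z ⊹ inf y z) := by
  have hz : ∀ w : M, le (inf (x ⊹ y) z) (w ⊹ z) := fun w =>
    le_trans (inf_le_right _ _) (le_oplus_left w z)
  refine oplus_inf_le ?_ (hz _)
  rw [oplus_comm (inf x z)]
  refine oplus_inf_le ?_ (hz _)
  rw [oplus_comm y x]
  exact inf_le_left _ _

/-- An element below both a truncated difference and its reverse is zero. -/
theorem inf_sub_sub (x y : M) : inf (∼(∼x ⊹ y)) (∼(∼y ⊹ x)) = zero := by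
  -- The point is `(x ⊖ y) ⊕ (x ∧ y) = x`, where `x ∧ y = x ⊖ (x ⊖ y)`.
  have aux : ∀ x y t : M, le t (∼(∼x ⊹ y)) → le (t ⊹ inf x y) x := fun x y t ht => by
    have h : le (∼x ⊹ y) (∼t) := le_neg_comm ht
    have h1 : le (∼(∼x ⊹ y)) x := neg_le_comm (le_oplus_right (∼x) y)
    have h2 := sub_oplus_cancel h1
    rw [inf_comm, inf, oplus_comm y, oplus_comm _ (∼x)]
    rw [oplus_comm] at h2
    have h3 := oplus_le_oplus ht (le_refl (∼(∼x ⊹ ∼(∼x ⊹ y))))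
    rwa [h2] at h3
  set t := inf (∼(∼x ⊹ y)) (∼(∼y ⊹ x))
  have h1 : le t (∼(∼x ⊹ y)) := inf_le_left _ _
  have h2 : le t (∼(∼y ⊹ x)) := inf_le_right _ _
  have h3 : le (t ⊹ inf x y) (inf x y) :=
    le_inf (aux x y t h1) (by rw [inf_comm]; exact aux y x t h2)
  have h4 : le (inf x y) (∼t) :=
    le_trans (inf_le_right x y) (le_trans (le_oplus_left (∼x) y) (le_neg_comm h1))
  -- Since `x ∧ y ≤ ¬t`, adding `x ∧ y` to `¬t ⊖ (x ∧ y)` recovers `¬t`; by `h3` the same sum is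
  -- `1`.
  have h5 := sub_oplus_cancel h4
  rw [neg_neg, le_iff.1 h3] at *
  exact neg_injective h5.symm

end Basic

/-! ### Carry identities in chains -/

section Chain

variable {M : Type u} [MVAlgebra M]

theorem tprod_ne_one {x y : M} (hx : x ≠ ∼zero) : ∼(∼x ⊹ ∼y) ≠ ∼zero := fun h =>
  hx (by rw [← oplus_eq_zero (neg_injective h), neg_neg])

/-- In a chain, `x ⊕ y ≠ 1` forces `x ⊙ y = 0`. -/
theorem IsChain.neg_oplus_neg (hM : IsChain M) {x y : M} (h : x ⊹ y ≠ ∼zero) :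
    ∼x ⊹ ∼y = ∼zero := by
  rcases hM x (∼y) with h' | h'
  · exact h'
  · exact absurd (by rw [le_iff, neg_neg, oplus_comm] at h'; exact h') h

/-- If `r ⊙ a = 0` and `r ⊙ b = 0`, then `(r ⊕ a) ⊙ b` is symmetric in `a` and `b`
whenever `r ⊕ a ⊕ b = 1`; written with `⊕` and `¬` only. -/
theorem tprod_right_comm {r a b : M} (ha : ∼r ⊹ ∼a = ∼zero) (hb : ∼r ⊹ ∼b = ∼zero) :
    ∼(r ⊹ a) ⊹ ∼b = ∼(r ⊹ b) ⊹ ∼a := by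
  have h1 := sub_oplus_cancel (le_iff.2 ha)
  have h2 := sub_oplus_cancel (le_iff.2 hb)
  rw [neg_neg] at h1 h2
  -- As `r ≤ ¬a` and `r ≤ ¬b`, both sides equal `¬(r ⊕ a) ⊕ ¬(r ⊕ b) ⊕ r`.
  have e : ∼(r ⊹ a) ⊹ (∼(b ⊹ r) ⊹ r) = ∼(r ⊹ b) ⊹ (∼(a ⊹ r) ⊹ r) := by
    rw [oplus_comm a r, oplus_comm b r]; ac_rfl
  rwa [h1, h2] at e

/-- Put `d = r ⊙ b`. Then `r = d ⊕ ¬b`, so `r ⊕ a = (d ⊕ a) ⊕ ¬b`. Linearity forces `d ⊕ a ≤ b`, as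
otherwise this sum is `1`; hence multiplying by `b` gives back `d ⊕ a`. -/
theorem IsChain.oplus_tprod_comm (hM : IsChain M) {r a b : M} (ha : r ⊹ a ≠ ∼zero)
    (hb : r ⊹ b = ∼zero) :
    ∼(r ⊹ a) ⊹ ∼b = ∼(∼(∼r ⊹ ∼b) ⊹ a) ∧ ∼(∼r ⊹ ∼b) ⊹ a ≠ ∼zero := by
  have h1 : ∼(∼r ⊹ ∼b) ⊹ ∼b = r := sub_oplus_cancel (by rwa [le_iff, neg_neg, oplus_comm])
  set d := ∼(∼r ⊹ ∼b)
  have h2 : r ⊹ a = d ⊹ a ⊹ ∼b := by rw [← h1]; ac_rfl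
  have h3 : le (d ⊹ a) b := (hM _ _).resolve_right fun h => ha <| eq_one_of_one_le <| by
    rw [h2, ← neg_oplus_self b, oplus_comm (∼b)]
    exact oplus_le_oplus h (le_refl _)
  refine ⟨?_, fun h => ha ?_⟩
  · have := inf_eq_left h3
    rw [inf, ← h2] at this
    rw [← this, neg_neg]
  · rw [h2, h, one_oplus]

end Chain

/-! ### Chang's group of a chain -/

/-- The elements `n + a` with `n` an integer and `a < 1` in an MV-algebra. In the case of a chain
these form the totally ordered abelian group whose unit interval is the chain. -/
@[ext]
structure ChangGroup (M : Type u) [MVAlgebra M] where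
  int : ℤ
  frac : M
  frac_ne : frac ≠ ∼zero

namespace ChangGroup

variable {M : Type u} [MVAlgebra M]

open Classical in
/-- Addition with carry. -/
noncomputable instance : Add (ChangGroup M) where
  add x y := if h : x.frac ⊹ y.frac = ∼zero
    then ⟨x.int + y.int + 1, ∼(∼x.frac ⊹ ∼y.frac), tprod_ne_one x.frac_ne⟩
    else ⟨x.int + y.int, x.frac ⊹ y.frac, h⟩

theorem add_of_ne {x y : ChangGroup M} (h : x.frac ⊹ y.frac ≠ ∼zero) :
    x + y = ⟨x.int + y.int, x.frac ⊹ y.frac, h⟩ := dif_neg h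

theorem add_of_eq {x y : ChangGroup M} (h : x.frac ⊹ y.frac = ∼zero) :
    x + y = ⟨x.int + y.int + 1, ∼(∼x.frac ⊹ ∼y.frac), tprod_ne_one x.frac_ne⟩ := dif_pos h

theorem add_comm' (x y : ChangGroup M) : x + y = y + x := by
  by_cases h : x.frac ⊹ y.frac = ∼zero
  · rw [add_of_eq h, add_of_eq (by rwa [oplus_comm])]
    ext
    · simp only; ring
    · simp only [oplus_comm]
  · rw [add_of_ne h, add_of_ne (by rwa [oplus_comm])]
    ext
    · simp only; ring
    · simp only [oplus_comm]

theorem add_right_comm_of_ne_of_eq (hM : IsChain M) {x y z : ChangGroup M}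
    (hy : x.frac ⊹ y.frac ≠ ∼zero) (hz : x.frac ⊹ z.frac = ∼zero) :
    x + y + z = x + z + y := by
  obtain ⟨h1, h2⟩ := hM.oplus_tprod_comm hy hz
  have h3 : x.frac ⊹ y.frac ⊹ z.frac = ∼zero := by
    rw [← oplus_assoc, oplus_comm y.frac, oplus_assoc, hz, one_oplus]
  rw [add_of_ne hy, add_of_eq hz, add_of_eq h3, add_of_ne h2]
  ext
  · simp only; ring
  · simp only [h1, neg_neg]

/-- With commutativity this is associativity, in a form symmetric in `y` and `z`; the cases are
whether `x + y` and `x + z` carry. -/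
theorem add_right_comm' (hM : IsChain M) (x y z : ChangGroup M) :
    x + y + z = x + z + y := by
  by_cases hy : x.frac ⊹ y.frac = ∼zero <;> by_cases hz : x.frac ⊹ z.frac = ∼zero
  -- Two carries are the dual of no carry: `tprod_right_comm` is applied to the negations.
  · have key : ∀ y z : ChangGroup M, x.frac ⊹ y.frac = ∼zero → x.frac ⊹ z.frac = ∼zero →
        ∼(∼x.frac ⊹ ∼y.frac) ⊹ z.frac ≠ ∼zero →
        ∼(∼x.frac ⊹ ∼y.frac) ⊹ z.frac = ∼(∼x.frac ⊹ ∼z.frac) ⊹ y.frac := by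
      intro y z hy hz h
      have := tprod_right_comm (r := ∼x.frac) (a := ∼y.frac) (b := ∼z.frac)
        (by rwa [neg_neg, neg_neg]) (by rwa [neg_neg, neg_neg])
      rwa [neg_neg, neg_neg] at this
    by_cases h : ∼(∼x.frac ⊹ ∼y.frac) ⊹ z.frac = ∼zero
    · have h' : ∼(∼x.frac ⊹ ∼z.frac) ⊹ y.frac = ∼zero := by
        by_contra h'
        exact h' ((key z y hz hy h').trans h)
      rw [add_of_eq hy, add_of_eq hz, add_of_eq h, add_of_eq h']
      ext
      · simp only; ring
      · simp only [neg_neg]; congr 1; ac_rfl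
    · have e := key y z hy hz h
      rw [add_of_eq hy, add_of_eq hz, add_of_ne h, add_of_ne (e ▸ h)]
      ext
      · simp only; ring
      · exact e
  · exact (add_right_comm_of_ne_of_eq hM hz hy).symm
  · exact add_right_comm_of_ne_of_eq hM hy hz
  · have e : x.frac ⊹ y.frac ⊹ z.frac = x.frac ⊹ z.frac ⊹ y.frac := by ac_rfl
    by_cases h : x.frac ⊹ y.frac ⊹ z.frac = ∼zero
    · rw [add_of_ne hy, add_of_ne hz, add_of_eq h, add_of_eq (e ▸ h)]
      ext
      · simp only; ring
      · simp only [tprod_right_comm (hM.neg_oplus_neg hy) (hM.neg_oplus_neg hz)]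
    · rw [add_of_ne hy, add_of_ne hz, add_of_ne h, add_of_ne (e ▸ h)]
      ext
      · simp only; ring
      · exact e

theorem zero_ne_one [Nontrivial M] : (zero : M) ≠ ∼zero := fun h => by
  obtain ⟨x, y, hxy⟩ := exists_pair_ne M
  have : ∀ z : M, z = zero := fun z => eq_zero_of_le_zero (h ▸ le_one z)
  exact hxy ((this x).trans (this y).symm)

instance [Nontrivial M] : Zero (ChangGroup M) := ⟨⟨0, zero, zero_ne_one⟩⟩

open Classical in
noncomputable instance [Nontrivial M] : Neg (ChangGroup M) where
  neg x := if h : x.frac = zero then ⟨-x.int, zero, zero_ne_one⟩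
    else ⟨-x.int - 1, ∼x.frac, fun e => h (neg_injective e)⟩

theorem zero_add' [Nontrivial M] (x : ChangGroup M) : 0 + x = x := by
  have e : (0 : ChangGroup M).frac ⊹ x.frac = x.frac := zero_oplus _
  rw [add_of_ne (by rw [e]; exact x.frac_ne)]
  ext
  · exact Int.zero_add _
  · exact e

theorem neg_add' [Nontrivial M] (x : ChangGroup M) : -x + x = 0 := by
  by_cases h : x.frac = zero
  · have e : -x = ⟨-x.int, zero, zero_ne_one⟩ := dif_pos h
    rw [e, add_of_ne (by simpa only [h, oplus_zero] using zero_ne_one)]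
    ext
    · exact Int.add_left_neg _
    · simp only [h, oplus_zero]; rfl
  · have e : -x = ⟨-x.int - 1, ∼x.frac, fun e => h (neg_injective e)⟩ := dif_neg h
    rw [e, add_of_eq (neg_oplus_self _)]
    ext
    · show -x.int - 1 + x.int + 1 = 0
      ring
    · show ∼(∼∼x.frac ⊹ ∼x.frac) = zero
      rw [neg_oplus_self, neg_neg]

/-- The group of Chang associated with an MV-chain. -/
noncomputable instance [Nontrivial M] [hM : Fact (IsChain M)] : AddCommGroup (ChangGroup M) where
  add_assoc x y z := by
    rw [add_comm' x y, add_right_comm' hM.out, add_comm' (y + z) x]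
  zero_add := zero_add'
  add_zero x := by rw [add_comm', zero_add']
  nsmul := nsmulRec
  zsmul := zsmulRec
  neg_add_cancel := neg_add'
  add_comm := add_comm'

end ChangGroup

/-! ### The chain inside its group, and the positive cone -/

namespace ChangGroup

section
variable {M : Type u} [MVAlgebra M]

theorem int_add_le (x y : ChangGroup M) : x.int + y.int ≤ (x + y).int := by
  by_cases h : x.frac ⊹ y.frac = ∼zero
  · rw [add_of_eq h]; simp
  · rw [add_of_ne h]

variable [Nontrivial M]

open Classical in
/-- The embedding of a nontrivial chain onto the unit interval of its group. -/
noncomputable def of (x : M) : ChangGroup M :=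
  if h : x = ∼zero then ⟨1, zero, zero_ne_one⟩ else ⟨0, x, h⟩

theorem of_one : of (∼zero : M) = ⟨1, zero, zero_ne_one⟩ := dif_pos rfl

theorem of_of_ne {x : M} (h : x ≠ ∼zero) : of x = ⟨0, x, h⟩ := dif_neg h

theorem of_zero : of (zero : M) = 0 := of_of_ne zero_ne_one

theorem of_ne_zero {x : M} (h : x ≠ zero) : of x ≠ 0 := by
  intro e
  by_cases hx : x = ∼zero
  · rw [hx, of_one] at e
    exact one_ne_zero (congrArg int e)
  · rw [of_of_ne hx] at e
    exact h (congrArg frac e)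

theorem int_of_nonneg (x : M) : 0 ≤ (of x).int := by
  by_cases hx : x = ∼zero
  · rw [hx, of_one]; exact zero_le_one
  · rw [of_of_ne hx]

end

variable {M : Type u} [MVAlgebra M] [Nontrivial M] [hM : Fact (IsChain M)]

/-- The hypothesis says `x ⊙ y = 0`, so a carry can only produce `1 + 0`, the image of `1`. -/
theorem of_oplus {x y : M} (h : le x (∼y)) : of (x ⊹ y) = of x + of y := by
  have aux : ∀ y : M, le (∼zero) (∼y) → y = zero := fun y h =>
    neg_injective (eq_one_of_one_le h)
  by_cases hx : x = ∼zero
  · subst hx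
    rw [aux y h, oplus_zero, of_zero, add_zero]
  by_cases hy : y = ∼zero
  · subst hy
    rw [aux x (le_neg_comm h), zero_oplus, of_zero, zero_add]
  rw [of_of_ne hx, of_of_ne hy]
  by_cases hxy : x ⊹ y = ∼zero
  · rw [add_of_eq hxy, hxy, of_one]
    ext
    · rfl
    · simp only [le_iff.1 h, neg_neg]
  · rw [add_of_ne hxy, of_of_ne hxy]
    rfl

variable (M) in
/-- The positive cone. -/
noncomputable def nonneg : AddSubmonoid (ChangGroup M) where
  carrier := {x | 0 ≤ x.int}
  zero_mem' := _root_.le_refl (0 : ℤ)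
  add_mem' {x y} hx hy := (add_nonneg hx hy).trans (int_add_le x y)

/-- A carry would make the integer part positive, so there is none, and both components vanish
separately. -/
theorem eq_zero_of_add_eq_zero {x y : ChangGroup M} (hx : x ∈ nonneg M) (hy : y ∈ nonneg M)
    (h : x + y = 0) : x = 0 := by
  have hx' : 0 ≤ x.int := hx
  have hy' : 0 ≤ y.int := hy
  have h0 : (x + y).int = 0 := by rw [h]; rfl
  by_cases hc : x.frac ⊹ y.frac = ∼zero
  · rw [add_of_eq hc] at h0
    simp only at h0
    omega
  · rw [add_of_ne hc] at h h0
    simp only at h0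
    ext
    · show x.int = 0
      omega
    · exact oplus_eq_zero (congrArg frac h)

/-- In a pointed cone every term of a vanishing sum is zero, and likewise no positive multiple of a
nonzero element is zero. -/
theorem exists_addMonoidHom_rat_pos_of {s : Set M} (hs : s.Finite) :
    ∃ f : ChangGroup M →+ ℚ, ∀ d ∈ s, d ≠ zero → 0 < f (of d) := by
  have hs' : (s \ {zero}).Finite := hs.sdiff
  obtain ⟨n, d, hd⟩ := hs'.fin_embedding
  have hmem : ∀ i, d i ≠ zero := fun i => (hd ▸ Set.mem_range_self i : d i ∈ s \ {zero}).2
  obtain ⟨f, hf⟩ := exists_addMonoidHom_rat_pos (fun i => of (d i)) fun c hc => by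
    have hn : ∀ i, of (d i) ∈ nonneg M := fun i => int_of_nonneg (d i)
    funext i
    have h1 : c i • of (d i) = 0 := by
      rw [← Finset.add_sum_erase _ _ (Finset.mem_univ i)] at hc
      exact eq_zero_of_add_eq_zero (AddSubmonoid.nsmul_mem _ (hn i) _)
        (AddSubmonoid.sum_mem _ fun j _ => AddSubmonoid.nsmul_mem _ (hn j) _) hc
    by_contra h2
    obtain ⟨m, hm⟩ := Nat.exists_eq_succ_of_ne_zero h2
    rw [hm, succ_nsmul'] at h1
    exact of_ne_zero (hmem i)
      (eq_zero_of_add_eq_zero (hn i) (AddSubmonoid.nsmul_mem _ (hn i) _) h1)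
  refine ⟨f, fun x hx h0 => ?_⟩
  obtain ⟨i, rfl⟩ : x ∈ Set.range d := by rw [hd]; exact ⟨hx, h0⟩
  exact hf i

end ChangGroup

/-! ### Rational valuations and embeddings into `Ł_k` -/

variable {M : Type u} [MVAlgebra M]

/-- A nontrivial chain has a rational-valued additive function that is strictly monotone on a
prescribed finite subset. -/
theorem IsChain.exists_rat_valuation [Nontrivial M] (hM : IsChain M) {s : Set M} (hs : s.Finite) :
    ∃ w : M → ℚ, w (∼zero) = 1 ∧ (∀ x y, le x (∼y) → w (x ⊹ y) = w x + w y) ∧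
      ∀ x ∈ s, ∀ y ∈ s, le x y → x ≠ y → w x < w y := by
  have : Fact (IsChain M) := ⟨hM⟩
  -- Positivity at `y ⊖ x` gives strict monotonicity, because `y = (y ⊖ x) ⊕ x` without overflow;
  -- positivity at `1` permits normalization.
  obtain ⟨f, hf⟩ := ChangGroup.exists_addMonoidHom_rat_pos_of
    (((hs.prod hs).image fun p => ∼(∼p.2 ⊹ p.1)).insert (∼(zero : M)))
  have h1 : 0 < f (ChangGroup.of (∼(zero : M))) :=
    hf _ (Set.mem_insert _ _) ChangGroup.zero_ne_one.symm
  refine ⟨fun x => f (ChangGroup.of x) / f (ChangGroup.of (∼zero)), div_self h1.ne',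
    fun x y h => ?_, fun x hx y hy hxy hne => ?_⟩
  · simp only [ChangGroup.of_oplus h, map_add, add_div]
  · refine div_lt_div_of_pos_right ?_ h1
    have h2 : ∼(∼y ⊹ x) ≠ zero := fun h => hne <| le_antisymm hxy <| neg_injective (h.trans (neg_neg _).symm)
    have h3 := hf _ (Set.mem_insert_of_mem _ ⟨(x, y), ⟨hx, hy⟩, rfl⟩) h2
    have h4 : le (∼(∼y ⊹ x)) (∼x) := neg_le_neg (le_oplus_left _ _)
    have h5 := ChangGroup.of_oplus h4
    rw [sub_oplus_cancel hxy] at h5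
    rw [h5, map_add]
    exact lt_add_of_pos_left _ h3

/-- The part of the definition of a partial embedding that concerns the operations. -/
structure IsPartialHom {A : Type u} {B : Type v} [MVAlgebra A] [MVAlgebra B]
    (X : Set A) (ρ : X → B) : Prop where
  map_zero : ∀ h : (zero : A) ∈ X, ρ ⟨zero, h⟩ = zero
  map_neg : ∀ (x : X) (h : ∼(x : A) ∈ X), ρ ⟨∼(x : A), h⟩ = ∼(ρ x)
  map_oplus : ∀ (x y : X) (h : (x : A) ⊹ (y : A) ∈ X),
    ρ ⟨(x : A) ⊹ (y : A), h⟩ = ρ x ⊹ ρ y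

theorem exists_common_denominator {α : Type*} {X : Set α} (hX : X.Finite) (w : α → ℚ) :
    ∃ k : ℕ+, ∀ x ∈ X, 0 ≤ w x → w x ≤ 1 →
      ∃ i : ℕ, i ≤ (k : ℕ) ∧ (w x : ℝ) = (i : ℝ) / ((k : ℕ) : ℝ) := by
  refine ⟨⟨∏ x ∈ hX.toFinset, (w x).den, Finset.prod_pos fun x _ => (w x).den_pos⟩, ?_⟩
  intro x hx h0 h1
  have hpos : 0 < ∏ x ∈ hX.toFinset, (w x).den := Finset.prod_pos fun x _ => (w x).den_pos
  obtain ⟨m, hm⟩ : (w x).den ∣ ∏ x ∈ hX.toFinset, (w x).den :=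
    Finset.dvd_prod_of_mem _ (hX.mem_toFinset.2 hx)
  simp only [PNat.mk_coe]
  rw [hm] at hpos ⊢
  have hd : (w x).den ≠ 0 := (w x).den_pos.ne'
  have hm0 : m ≠ 0 := by rintro rfl; simp at hpos
  obtain ⟨j, hj⟩ := Int.eq_ofNat_of_zero_le (Rat.num_nonneg.2 h0)
  have e : w x = (j : ℚ) / (w x).den := by
    conv_lhs => rw [← Rat.num_div_den (w x), hj]
    simp
  refine ⟨j * m, Nat.mul_le_mul_right _ ?_, ?_⟩
  · rw [e, div_le_one (by positivity)] at h1
    exact_mod_cast h1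
  · have e' : (w x : ℝ) = (j : ℝ) / ((w x).den : ℝ) := by
      conv_lhs => rw [e]
      push_cast
      rfl
    rw [e']
    push_cast
    rw [mul_div_mul_right _ _ (by exact_mod_cast hm0)]

theorem IsChain.exists_isPartialEmbedding_finChain [Nontrivial M] (hM : IsChain M) {X : Set M}
    (hX : X.Finite) : ∃ (k : ℕ+) (ρ : X → FinChain k), IsPartialEmbedding X ρ := by
  -- The constants bound the values by `0` and `1`; negations are included so that `¬y ≤ x` yields
  -- `1 ≤ w x + w y` when a sum is truncated.
  obtain ⟨w, w1, wadd, wlt⟩ := hM.exists_rat_valuation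
    ((hX.union (hX.image neg)).union (Set.toFinite {zero, ∼zero}))
  set Y := X ∪ neg '' X ∪ {zero, ∼zero}
  have hXY : ∀ x ∈ X, x ∈ Y := fun x hx => Or.inl (Or.inl hx)
  have hnY : ∀ x ∈ X, ∼x ∈ Y := fun x hx => Or.inl (Or.inr ⟨x, hx, rfl⟩)
  have h0Y : zero ∈ Y := Or.inr (Or.inl rfl)
  have h1Y : ∼zero ∈ Y := Or.inr (Or.inr rfl)
  have wle : ∀ x ∈ Y, ∀ y ∈ Y, le x y → w x ≤ w y := fun x hx y hy h => by
    by_cases e : x = y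
    · rw [e]
    · exact (wlt x hx y hy h e).le
  have w0 : w zero = 0 := by
    have := wadd zero zero (zero_le _)
    rw [oplus_zero] at this
    linarith
  have wneg : ∀ x, w (∼x) = 1 - w x := fun x => by
    have := wadd (∼x) x (le_refl _)
    rw [neg_oplus_self, w1] at this
    linarith
  have h0 : ∀ x ∈ X, 0 ≤ w x := fun x hx => w0 ▸ wle _ h0Y _ (hXY x hx) (zero_le x)
  have h1 : ∀ x ∈ X, w x ≤ 1 := fun x hx => w1 ▸ wle _ (hXY x hx) _ h1Y (le_one x)
  obtain ⟨k, hk⟩ := exists_common_denominator hX w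
  refine ⟨k, fun x => ⟨(w x : ℝ), hk x x.2 (h0 x x.2) (h1 x x.2)⟩, ?_, ?_, ?_, ?_⟩
  · rintro ⟨x, hx⟩ ⟨y, hy⟩ h
    have e : w x = w y := Rat.cast_injective (α := ℝ) (congrArg Subtype.val h)
    by_contra hne
    have hne' : x ≠ y := fun h => hne (Subtype.ext h)
    rcases hM x y with h | h
    · exact (wlt x (hXY x hx) y (hXY y hy) h hne').ne e
    · exact (wlt y (hXY y hy) x (hXY x hx) h hne'.symm).ne e.symm
  · intro h
    refine Subtype.ext ?_
    show ((w zero : ℚ) : ℝ) = 0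
    rw [w0, Rat.cast_zero]
  · intro x h
    refine Subtype.ext ?_
    show ((w (∼(x : M)) : ℚ) : ℝ) = 1 - (w x : ℝ)
    rw [wneg]
    push_cast
    rfl
  · intro x y h
    refine Subtype.ext ?_
    show ((w ((x : M) ⊹ y) : ℚ) : ℝ) = min ((w x : ℝ) + (w y : ℝ)) 1
    suffices w ((x : M) ⊹ y) = min (w x + w y) 1 by rw [this]; push_cast; rfl
    rcases hM x (∼(y : M)) with hle | hle
    · rw [wadd _ _ hle, min_eq_left]
      rw [← wadd _ _ hle]
      exact h1 _ h
    · have e : (x : M) ⊹ y = ∼zero := by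
        rw [le_iff, neg_neg, oplus_comm] at hle
        exact hle
      have := wle _ (hnY y y.2) _ (hXY x x.2) hle
      rw [wneg] at this
      rw [e, w1, min_eq_right]
      linarith

/-! ### Prime ideals and quotient chains -/

/-- Ideals of an MV-algebra. -/
structure IsIdeal {M : Type u} [MVAlgebra M] (P : Set M) : Prop where
  zero_mem : zero ∈ P
  oplus_mem : ∀ {x y}, x ∈ P → y ∈ P → x ⊹ y ∈ P
  mem_of_le : ∀ {x y}, le x y → y ∈ P → x ∈ P

namespace IsIdeal

variable {M : Type u} [MVAlgebra M]

theorem singleton_zero : IsIdeal ({zero} : Set M) where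
  zero_mem := rfl
  oplus_mem {x y} hx hy := by
    rw [Set.mem_singleton_iff.1 hx, Set.mem_singleton_iff.1 hy, oplus_zero]; rfl
  mem_of_le {x y} h hy := eq_zero_of_le_zero (Set.mem_singleton_iff.1 hy ▸ h)

theorem sUnion {c : Set (Set M)} (hc : ∀ P ∈ c, IsIdeal P) (hchain : _root_.IsChain (· ⊆ ·) c)
    (hne : c.Nonempty) : IsIdeal (⋃₀ c) where
  zero_mem := by
    obtain ⟨P, hP⟩ := hne
    exact ⟨P, hP, (hc P hP).zero_mem⟩
  oplus_mem := by
    rintro x y ⟨P, hP, hx⟩ ⟨Q, hQ, hy⟩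
    rcases hchain.total hP hQ with h | h
    · exact ⟨Q, hQ, (hc Q hQ).oplus_mem (h hx) hy⟩
    · exact ⟨P, hP, (hc P hP).oplus_mem hx (h hy)⟩
  mem_of_le := by
    rintro x y h ⟨P, hP, hy⟩
    exact ⟨P, hP, (hc P hP).mem_of_le h hy⟩

theorem setOf_inf_mem {P : Set M} (hP : IsIdeal P) (z : M) : IsIdeal {x | inf x z ∈ P} where
  zero_mem := hP.mem_of_le (inf_le_left _ _) hP.zero_mem
  oplus_mem hx hy := hP.mem_of_le (oplus_inf_le_inf_oplus_inf _ _ _) (hP.oplus_mem hx hy)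
  mem_of_le h hy := hP.mem_of_le (inf_le_inf_left z h) hy

/-- An element different from zero is avoided by an ideal whose quotient is a chain. -/
theorem exists_prime {a : M} (ha : a ≠ zero) :
    ∃ P : Set M, IsIdeal P ∧ a ∉ P ∧ ∀ x y : M, inf x y = zero → x ∈ P ∨ y ∈ P := by
  obtain ⟨P, -, hP⟩ := zorn_subset_nonempty {P : Set M | IsIdeal P ∧ a ∉ P}
    (fun c hc hchain hne => ⟨⋃₀ c, ⟨sUnion (fun P hP => (hc hP).1) hchain hne, by
      rintro ⟨P, hP, haP⟩
      exact (hc hP).2 haP⟩, fun s hs => Set.subset_sUnion_of_mem hs⟩)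
    {zero} ⟨singleton_zero, ha⟩
  obtain ⟨hI, haP⟩ := hP.prop
  -- The ideal `{x | x ∧ z ∈ P}` contains `P` and avoids `a`, so by maximality it is `P`.
  have key : ∀ z : M, inf a z ∉ P → ∀ x, inf x z ∈ P → x ∈ P := fun z hz x hx =>
    hP.le_of_ge (y := {x | inf x z ∈ P}) ⟨hI.setOf_inf_mem z, hz⟩
      (fun y hy => hI.mem_of_le (inf_le_left _ _) hy) hx
  refine ⟨P, hI, haP, fun x y hxy => or_iff_not_imp_left.2 fun hx => ?_⟩
  -- Two uses of `key`: with `z = a`, `x ∉ P` gives `a ∧ x ∉ P`; then with `z = x`, `y ∧ x = 0`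
  -- gives `y ∈ P`.
  refine key x (fun hax => hx ?_) y (by rw [inf_comm, hxy]; exact hI.zero_mem)
  exact key a (by rwa [inf_self]) x (by rwa [inf_comm])

theorem sub_sub_sub_mem {P : Set M} (hP : IsIdeal P) {x y z : M} (h : ∼(∼x ⊹ y) ∈ P)
    (h' : ∼(∼y ⊹ z) ∈ P) : ∼(∼x ⊹ z) ∈ P := by
  refine hP.mem_of_le (sub_le_iff.2 ?_) (hP.oplus_mem h' h)
  rw [oplus_assoc]
  exact sub_le_iff.1 (neg_le_neg (oplus_le_oplus (le_refl _) (sub_le_iff.1 (le_refl _))))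

theorem sub_oplus_mem {P : Set M} (hP : IsIdeal P) {x y z w : M} (h : ∼(∼x ⊹ y) ∈ P)
    (h' : ∼(∼z ⊹ w) ∈ P) : ∼(∼(x ⊹ z) ⊹ (y ⊹ w)) ∈ P := by
  refine hP.mem_of_le (sub_le_iff.2 ?_) (hP.oplus_mem h h')
  have e : y ⊹ w ⊹ (∼(∼x ⊹ y) ⊹ ∼(∼z ⊹ w)) = y ⊹ ∼(∼x ⊹ y) ⊹ (w ⊹ ∼(∼z ⊹ w)) := by ac_rfl
  rw [e]
  exact oplus_le_oplus (sub_le_iff.1 (le_refl _)) (sub_le_iff.1 (le_refl _))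

/-- Congruence modulo an ideal. -/
def setoid {P : Set M} (hP : IsIdeal P) : Setoid M where
  r x y := ∼(∼x ⊹ y) ∈ P ∧ ∼(∼y ⊹ x) ∈ P
  iseqv := by
    refine ⟨fun x => ?_, fun h => ⟨h.2, h.1⟩, fun h h' =>
      ⟨hP.sub_sub_sub_mem h.1 h'.1, hP.sub_sub_sub_mem h'.2 h.2⟩⟩
    rw [neg_oplus_self, neg_neg]
    exact ⟨hP.zero_mem, hP.zero_mem⟩

/-- The quotient by an ideal. -/
abbrev Quot {P : Set M} (hP : IsIdeal P) : Type u := Quotient hP.setoid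

instance {P : Set M} (hP : IsIdeal P) : MVAlgebra hP.Quot where
  oplus := Quotient.map₂ oplus fun _ _ h _ _ h' =>
    ⟨hP.sub_oplus_mem h.1 h'.1, hP.sub_oplus_mem h.2 h'.2⟩
  neg := Quotient.map neg fun x y h => by
    have h1 : ∼(∼∼x ⊹ ∼y) ∈ P := by rw [neg_neg, oplus_comm]; exact h.2
    have h2 : ∼(∼∼y ⊹ ∼x) ∈ P := by rw [neg_neg, oplus_comm]; exact h.1
    exact ⟨h1, h2⟩
  zero := Quotient.mk _ zero
  oplus_comm := by
    rintro ⟨x⟩ ⟨y⟩; exact congrArg (Quotient.mk _) (oplus_comm x y)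
  oplus_assoc := by
    rintro ⟨x⟩ ⟨y⟩ ⟨z⟩; exact congrArg (Quotient.mk _) (oplus_assoc x y z)
  oplus_zero := by
    rintro ⟨x⟩; exact congrArg (Quotient.mk _) (oplus_zero x)
  neg_neg := by
    rintro ⟨x⟩; exact congrArg (Quotient.mk _) (neg_neg x)
  oplus_one := by
    rintro ⟨x⟩; exact congrArg (Quotient.mk _) (oplus_one x)
  lukasiewicz := by
    rintro ⟨x⟩ ⟨y⟩; exact congrArg (Quotient.mk _) (lukasiewicz x y)

/-- Since `(x ⊖ y) ∧ (y ⊖ x) = 0`, primeness puts one of the differences into `P`. -/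
theorem isChain_quot {P : Set M} (hP : IsIdeal P)
    (hprime : ∀ x y : M, inf x y = zero → x ∈ P ∨ y ∈ P) : IsChain hP.Quot := by
  have key : ∀ x y : M, ∼(∼x ⊹ y) ∈ P →
      le (Quotient.mk hP.setoid x) (Quotient.mk hP.setoid y) := fun x y h => by
    refine Quotient.sound (a := ∼x ⊹ y) (b := ∼zero) ⟨?_, ?_⟩
    · rw [oplus_one, neg_neg]
      exact hP.zero_mem
    · rwa [neg_neg, zero_oplus]
  rintro ⟨x⟩ ⟨y⟩
  exact (hprime _ _ (inf_sub_sub x y)).imp (key x y) (key y x)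

end IsIdeal

/-! ### Separating points and embedding into powers -/

variable {M : Type u} [MVAlgebra M]

/-- By antisymmetry one of `x ⊖ y`, `y ⊖ x` is nonzero; a prime ideal avoiding it keeps `x` and `y`
apart. -/
theorem exists_hom_chain_ne {x y : M} (hxy : x ≠ y) :
    ∃ (C : Type u) (_ : MVAlgebra C) (f : M → C), IsChain C ∧ f zero = zero ∧
      (∀ x, f (∼x) = ∼(f x)) ∧ (∀ x y, f (x ⊹ y) = f x ⊹ f y) ∧ f x ≠ f y := by
  have aux : ∀ a : M, a ≠ zero → (∀ P : Set M, IsIdeal P → a ∉ P →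
      ¬(∼(∼x ⊹ y) ∈ P ∧ ∼(∼y ⊹ x) ∈ P)) → ∃ (C : Type u) (_ : MVAlgebra C) (f : M → C),
      IsChain C ∧ f zero = zero ∧
      (∀ x, f (∼x) = ∼(f x)) ∧ (∀ x y, f (x ⊹ y) = f x ⊹ f y) ∧ f x ≠ f y := by
    intro a ha h
    obtain ⟨P, hP, haP, hprime⟩ := IsIdeal.exists_prime ha
    exact ⟨hP.Quot, inferInstance, Quotient.mk hP.setoid, hP.isChain_quot hprime, rfl,
      fun _ => rfl, fun _ _ => rfl, fun e => h P hP haP (Quotient.exact e)⟩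
  by_cases h1 : ∼(∼x ⊹ y) = zero
  · by_cases h2 : ∼(∼y ⊹ x) = zero
    · exact absurd (le_antisymm (neg_injective (h1.trans (neg_neg _).symm))
        (neg_injective (h2.trans (neg_neg _).symm))) hxy
    · exact aux _ h2 fun P _ hn h => hn h.2
  · exact aux _ h1 fun P _ hn h => hn h.1

/-- The map to the chain may identify other points of `X`, so only a partial homomorphism results;
the chosen pair stays apart. -/
theorem exists_isPartialHom_finChain_ne {X : Set M} (hX : X.Finite) {x y : X} (hxy : x ≠ y) :
    ∃ (k : ℕ+) (ρ : X → FinChain k), IsPartialHom X ρ ∧ ρ x ≠ ρ y := by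
  obtain ⟨C, _, f, hC, f0, fneg, fadd, hf⟩ := exists_hom_chain_ne (fun h => hxy (Subtype.ext h))
  have : Nontrivial C := ⟨_, _, hf⟩
  obtain ⟨k, ρ, hρ⟩ := hC.exists_isPartialEmbedding_finChain (hX.image f)
  have congr : ∀ {c d : C} (h : c = d) (hc : c ∈ f '' X), ρ ⟨c, hc⟩ = ρ ⟨d, h ▸ hc⟩ := by
    rintro c _ rfl _; rfl
  refine ⟨k, fun z => ρ ⟨f z, Set.mem_image_of_mem f z.2⟩, ⟨fun h => ?_, fun z h => ?_,
    fun z t h => ?_⟩, fun h => hf (congrArg Subtype.val (hρ.injective h))⟩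
  · exact (congr f0 _).trans (hρ.map_zero _)
  · exact (congr (fneg z) _).trans (hρ.map_neg ⟨f z, Set.mem_image_of_mem f z.2⟩ _)
  · exact (congr (fadd z t) _).trans (hρ.map_oplus ⟨f z, Set.mem_image_of_mem f z.2⟩
      ⟨f t, Set.mem_image_of_mem f t.2⟩ _)

/-- The inclusion of `Ł_k` in `Ł_m` when `k` divides `m`. -/
def FinChain.ofDvd {k m : ℕ+} (h : (k : ℕ) ∣ m) (x : FinChain k) : FinChain m :=
  ⟨x.1, by
    obtain ⟨_, i, hi, rfl⟩ := x
    obtain ⟨c, hc⟩ := h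
    have hc0 : (c : ℝ) ≠ 0 := by
      rintro e
      have : c = 0 := by exact_mod_cast e
      exact m.pos.ne' (by rw [hc, this, mul_zero])
    refine ⟨i * c, hc ▸ Nat.mul_le_mul_right c hi, ?_⟩
    rw [hc, Nat.cast_mul, Nat.cast_mul, mul_div_mul_right _ _ hc0]⟩

theorem FinChain.ofDvd_injective {k m : ℕ+} (h : (k : ℕ) ∣ m) :
    Function.Injective (FinChain.ofDvd h) := fun _ _ e =>
  Subtype.ext (congrArg (fun z : FinChain m => z.1) e)

theorem IsPartialHom.ofDvd {X : Set M} {k m : ℕ+} (h : (k : ℕ) ∣ m) {ρ : X → FinChain k}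
    (hρ : IsPartialHom X ρ) : IsPartialHom X fun x => FinChain.ofDvd h (ρ x) where
  map_zero h0 := by rw [hρ.map_zero]; rfl
  map_neg x hx := by rw [hρ.map_neg]; rfl
  map_oplus x y hxy := by rw [hρ.map_oplus]; rfl

/-- One coordinate per ordered pair of distinct points; the product of the `k p` is a common `k`. If
`X` has at most one point then `l = 0`, which covers the trivial algebra. -/
theorem exists_isPartialEmbedding_pow {X : Set M} (hX : X.Finite) :
    ∃ (k : ℕ+) (l : ℕ) (ρ : X → (Fin l → FinChain k)), IsPartialEmbedding X ρ := by
  have := hX.to_subtype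
  let I := {p : X × X // p.1 ≠ p.2}
  have : Fintype I := Fintype.ofFinite I
  choose k ρ hρ hne using fun p : I => exists_isPartialHom_finChain_ne hX p.2
  let m : ℕ+ := ∏ p, k p
  have hm : ∀ p, (k p : ℕ) ∣ m := fun p =>
    PNat.dvd_iff.1 (Finset.dvd_prod_of_mem k (Finset.mem_univ p))
  let e := Fintype.equivFin I
  have hσ := fun p => (hρ p).ofDvd (hm p)
  refine ⟨m, Fintype.card I, fun x j => FinChain.ofDvd (hm (e.symm j)) (ρ (e.symm j) x),
    fun x y h => ?_, fun h => ?_, fun x h => ?_, fun x y h => ?_⟩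
  · by_contra hxy
    have h' := congrFun h (e ⟨(x, y), hxy⟩)
    have h'' := FinChain.ofDvd_injective _ h'
    rw [e.symm_apply_apply] at h''
    exact hne _ h''
  · exact funext fun j => (hσ _).map_zero h
  · exact funext fun j => (hσ _).map_neg x h
  · exact funext fun j => (hσ _).map_oplus x y h

/-! ### Finiteness and linearity of `Ł_k`, universe lifting -/

instance (k : ℕ+) : Finite (FinChain k) :=
  Set.Finite.to_subtype <| (Set.finite_range fun i : Fin (k + 1) => (i : ℝ) / ((k : ℕ) : ℝ)).subset
    fun _ ⟨i, hi, h⟩ => ⟨⟨i, Nat.lt_succ_of_le hi⟩, h.symm⟩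

theorem FinChain.isChain (k : ℕ+) : IsChain (FinChain k) := by
  have key : ∀ x y : FinChain k, x.1 ≤ y.1 → le x y := fun x y h => Subtype.ext <| by
    show min (1 - x.1 + y.1) 1 = 1 - 0
    rw [sub_zero, min_eq_right]
    linarith
  exact fun x y => (le_total x.1 y.1).imp (key x y) (key y x)

instance {A : Type u} [MVAlgebra A] : MVAlgebra (ULift.{v} A) where
  oplus x y := ⟨x.down ⊹ y.down⟩
  neg x := ⟨∼x.down⟩
  zero := ⟨zero⟩
  oplus_comm _ _ := congrArg ULift.up (oplus_comm _ _)
  oplus_assoc _ _ _ := congrArg ULift.up (oplus_assoc _ _ _)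
  oplus_zero _ := congrArg ULift.up (oplus_zero _)
  neg_neg _ := congrArg ULift.up (neg_neg _)
  oplus_one _ := congrArg ULift.up (oplus_one _)
  lukasiewicz _ _ := congrArg ULift.up (lukasiewicz _ _)

theorem IsChain.ulift {A : Type u} [MVAlgebra A] (h : IsChain A) : IsChain (ULift.{v} A) :=
  fun x y => (h x.down y.down).imp (congrArg ULift.up) (congrArg ULift.up)

theorem IsPartialEmbedding.ulift {A : Type*} {B : Type u} [MVAlgebra A] [MVAlgebra B] {X : Set A}
    {ρ : X → B} (h : IsPartialEmbedding X ρ) :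
    IsPartialEmbedding X fun x => (ULift.up (ρ x) : ULift.{v} B) where
  injective _ _ e := h.injective (congrArg ULift.down e)
  map_zero h0 := congrArg ULift.up (h.map_zero h0)
  map_neg x hx := congrArg ULift.up (h.map_neg x hx)
  map_oplus x y hxy := congrArg ULift.up (h.map_oplus x y hxy)

theorem isPartialEmbedding_val (X : Set M) : IsPartialEmbedding X (Subtype.val : X → M) :=
  ⟨Subtype.val_injective, fun _ => rfl, fun _ _ => rfl, fun _ _ _ => rfl⟩

end MVAlgebra

theorem theorem5 :
    -- (1) the class of linearly ordered MV-algebras has the FEP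
    (MVAlgebra.ClassHasFEP.{u} (fun A _ => MVAlgebra.LMV A) ∧
      -- in fact finite partial subalgebras of nontrivial chains embed into some `Ł_k`
      ∀ (M : Type u) [MVAlgebra M] [Nontrivial M], MVAlgebra.IsChain M →
        ∀ X : Set M, X.Finite →
          ∃ (k : ℕ+) (ρ : X → MVAlgebra.FinChain k), MVAlgebra.IsPartialEmbedding X ρ) ∧
    -- (2) the class of all MV-algebras has the FEP
    (MVAlgebra.ClassHasFEP.{u} (fun A _ => MVAlgebra.MV A) ∧
      -- in fact finite partial subalgebras embed into some finite power of some `Ł_k`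
      ∀ (M : Type u) [MVAlgebra M], ∀ X : Set M, X.Finite →
        ∃ (k : ℕ+) (l : ℕ) (ρ : X → (Fin l → MVAlgebra.FinChain k)),
          MVAlgebra.IsPartialEmbedding X ρ) := by
  refine ⟨⟨fun M _ hM X hX => ?_, fun M _ _ hM X hX => hM.exists_isPartialEmbedding_finChain hX⟩,
    fun M _ _ X hX => ?_, fun M _ X hX => MVAlgebra.exists_isPartialEmbedding_pow hX⟩
  -- In `Ł_k` the constants differ, so the one-element chain is handled by its own finiteness.
  · rcases subsingleton_or_nontrivial M with h | h
    · exact ⟨M, inferInstance, inferInstance, hM, _, MVAlgebra.isPartialEmbedding_val X⟩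
    · obtain ⟨k, ρ, hρ⟩ := MVAlgebra.IsChain.exists_isPartialEmbedding_finChain hM hX
      exact ⟨ULift (MVAlgebra.FinChain k), inferInstance, inferInstance,
        (MVAlgebra.FinChain.isChain k).ulift, _, hρ.ulift⟩
  · obtain ⟨k, l, ρ, hρ⟩ := MVAlgebra.exists_isPartialEmbedding_pow hX
    exact ⟨ULift (Fin l → MVAlgebra.FinChain k), inferInstance, inferInstance, trivial, _,
      hρ.ulift⟩
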